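/- All multigraphs are finite and have no loops. An $r$-factor of a multigraph $G$ is an $r$-regular spanning submultigraph of $G$. Let $\ell\ge 0$ be an integer and let $G$ be a multigraph on $n$ vertices in which every pair of vertices is joined by at most $\ell$ edges. Let $\delta$ and $\Delta$ denote the minimum and the maximum degree of $G$ (edges counted with multiplicity), and suppose that $\delta\ge \ell n/2$. (i) If $r\ge 0$ is an even integer with $$r\le \frac{\delta+\sqrt{\ell n(2\delta-\ell n)}}{2},$$ then $G$ contains an $r$-factor. (ii) For every real $\xi$ with $0<\xi<1/9$ there is an integer $n_0=n_0(\xi)$, independent of $\ell$ and $G$, such that the following holds. If $n\ge n_0$ and $$\left(\tfrac12+\xi\right)\ell n\le \Delta\le \delta+\xi^2\ell n,$$ and if $r\ge 0$ is an even integer with $r\le \delta-\xi\ell n$, then $G$ contains an $r$-factor. -/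

import Mathlib

namespace Graph

/-- The degree of a vertex in a multigraph: the number of incident edges, loops counted twice. -/
noncomputable def degree {α β : Type*} (G : Graph α β) (x : α) : ℕ :=
  (G.incidenceSet x).ncard + (G.loopSet x).ncard

/-- The minimum degree of a finite multigraph (`0` if there are no vertices). -/
noncomputable def minDegree {α β : Type*} (G : Graph α β) : ℕ :=
  sInf (G.degree '' G.vertexSet)

/-- The maximum degree of a finite multigraph (`0` if there are no vertices). -/
noncomputable def maxDegree {α β : Type*} (G : Graph α β) : ℕ :=
  sSup (G.degree '' G.vertexSet)

/-- Every pair of vertices is joined by at most `l` edges. The cardinality is taken in `ℕ∞`, so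
that infinite edge sets are excluded. -/
def MultiplicityLE {α β : Type*} (G : Graph α β) (l : ℕ) : Prop :=
  ∀ x y : α, {e : β | G.IsLink e x y}.encard ≤ l

/-- `H` is an `r`-factor of `G`: a spanning submultigraph in which every vertex has degree `r`. -/
def IsFactor {α β : Type*} (H G : Graph α β) (r : ℕ) : Prop :=
  H.IsSpanningSubgraph G ∧ ∀ x ∈ H.vertexSet, H.degree x = r

end Graph

/-!
Both parts follow from Tutte's `r`-factor theorem. Call `r|S| - r|T| + Σ_{v ∈ T} d(v) - e(S, T) - q`
Tutte's expression of disjoint vertex sets `S`, `T`, where `q` is the number of components `C` of the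
multigraph without `S ∪ T` for which `r|C| + e(C, T)`, hence, for even `r`, `e(C, T)`, is odd. If
there is no `r`-factor, then the expression is negative for some `S`, `T`, and even at most `-2`,
since it is even (`DartSystem.exists_factor_or_exists_barrier`).

The `r`-factor theorem is derived from Tutte's theorem on perfect matchings. In the gadget graph
`DartSystem.gadget`, each vertex is replaced by `r` copies and each edge by a path through its two
darts, so that perfect matchings correspond to `r`-factors. A smallest violator of Tutte's condition
in the gadget contains, at each vertex, either all copies and no dart, or all darts and no copy, or
neither (`SimpleGraph.exists_minimal_violator`). The vertices of the first two kinds form `S` and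
`T`. Components are replaced throughout by labellings that are constant along the remaining edges,
because merging labels is simpler than following components.

It remains to bound Tutte's expression from below, with `s = |S|` and `t = |T|`. One has
`e(S, T) ≤ l * s * t`, `e(S, T) ≤ s * Δ`, `q + e(S, T) ≤ Σ_{v ∈ T} d(v)`, `q ≤ n - s - t` and, by the
degree condition, `q ≤ s + t` if `t ≥ 1` (`DartSystem.card_odd_le`). The case `t ≤ s` is then
immediate. For `s < t` the rest is arithmetic: the first part comes down to the case `t = n - s`,
where a quadratic polynomial in `s` has no negative values for `2 * s ≤ n` by the stated bound on
`r` (`tutte_inequality_of_le_add_sqrt`); in the second part the two bounds on `e(S, T)` are used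
according to whether `l * t ≤ δ` (`tutte_inequality_of_almost_regular`).
-/

section

open Finset

/-! ### Labelled violators of Tutte's condition -/

namespace SimpleGraph

variable {X : Type*} [Fintype X] [DecidableEq X]

/-- The labels whose class outside `W` has odd size. When `c` labels the vertices outside `W` by
their component in `G - W`, these are the odd components of `G - W`. -/
def oddLabels (W : Finset X) (c : X → X) : Finset X :=
  {i | Odd #{x | x ∉ W ∧ c x = i}}

lemma mem_oddLabels {W : Finset X} {c : X → X} {i : X} :
    i ∈ oddLabels W c ↔ Odd #{x | x ∉ W ∧ c x = i} := by
  simp [oddLabels]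

lemma even_card_add_card_oddLabels (W : Finset X) (c : X → X) (hX : Even (Fintype.card X)) :
    Even (#W + #(oddLabels W c)) := by
  have h1 : #Wᶜ = ∑ i, #{x | x ∉ W ∧ c x = i} := by
    rw [card_eq_sum_card_fiberwise (f := c) (t := univ) (by simp)]
    refine sum_congr rfl fun i _ => congrArg card ?_
    ext x; simp
  have h2 := Finset.odd_sum_iff_odd_card_odd (s := univ) fun i => #{x | x ∉ W ∧ c x = i}
  rw [← h1] at h2
  have h3 := card_add_card_compl W
  have h4 : Odd #Wᶜ ↔ Odd #(oddLabels W c) := h2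
  rw [← h3] at hX
  rw [Nat.even_add] at hX ⊢
  rw [hX, ← Nat.not_odd_iff_even, ← Nat.not_odd_iff_even, h4]

/-- The hard direction of Tutte's theorem, with the components of `G - W` replaced by a labelling
that is constant along the edges of `G - W`. -/
lemma exists_card_lt_card_oddLabels (G : SimpleGraph X)
    (h : ¬ ∃ M : G.Subgraph, M.IsPerfectMatching) :
    ∃ W : Finset X, ∃ c : X → X, (∀ x y, x ∉ W → y ∉ W → G.Adj x y → c x = c y) ∧
      #W < #(oddLabels W c) := by
  classical
  rw [tutte] at h
  push Not at h
  obtain ⟨u, hu⟩ := h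
  set H := ((⊤ : G.Subgraph).deleteVerts u).coe with hH
  have hv : ∀ x, x ∉ u.toFinset → x ∈ ((⊤ : G.Subgraph).deleteVerts u).verts := by
    intro x hx; simpa using hx
  have hv' : ∀ x : ((⊤ : G.Subgraph).deleteVerts u).verts, x.1 ∉ u.toFinset := by
    rintro ⟨x, hx⟩; simpa using hx
  let c : X → X := fun x =>
    if hx : x ∉ u.toFinset then (H.connectedComponentMk ⟨x, hv x hx⟩).out.1 else x
  have hc : ∀ x (hx : x ∉ u.toFinset), c x = (H.connectedComponentMk ⟨x, hv x hx⟩).out.1 :=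
    fun x hx => dif_pos hx
  refine ⟨u.toFinset, c, ?_, ?_⟩
  · intro x y hx hy hxy
    rw [hc x hx, hc y hy]
    have : H.Adj ⟨x, hv x hx⟩ ⟨y, hv y hy⟩ := by
      simp only [hH, Subgraph.coe_adj, Subgraph.deleteVerts_adj]
      simp at hx hy
      simp [hx, hy, hxy]
    rw [ConnectedComponent.connectedComponentMk_eq_of_adj this]
  · have hinj : Function.Injective fun C : H.ConnectedComponent => C.out.1 := by
      intro C C' hCC
      have := Subtype.ext hCC
      rw [← C.out_eq, ← C'.out_eq, this]
    rw [IsTutteViolator, Set.ncard_eq_toFinset_card' u] at hu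
    refine hu.trans_le ?_
    rw [Set.ncard_eq_toFinset_card', ← card_image_of_injective _ hinj]
    refine card_le_card ?_
    intro i hi
    simp only [mem_image, Set.mem_toFinset] at hi
    obtain ⟨C, hC, rfl⟩ := hi
    rw [mem_oddLabels]
    have hC' : Odd C.supp.ncard := hC
    rw [← Set.ncard_image_of_injective _ Subtype.val_injective] at hC'
    rw [← Set.ncard_coe_finset]
    convert hC' using 2
    ext x
    simp only [coe_filter, mem_univ, true_and, Set.mem_ofPred_eq, Set.mem_image,
      ConnectedComponent.mem_supp_iff]
    constructor
    · rintro ⟨hx, hx'⟩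
      rw [hc x hx] at hx'
      exact ⟨⟨x, hv x hx⟩, hinj hx', rfl⟩
    · rintro ⟨y, hy, rfl⟩
      refine ⟨hv' y, ?_⟩
      rw [hc _ (hv' y)]
      exact congrArg (fun C : H.ConnectedComponent => C.out.1) hy

/-- Moving a vertex `x` out of `W` and merging the two labels that its neighbours carry destroys at
most one odd label. -/
lemma card_oddLabels_le_card_oddLabels_erase_add_one {W : Finset X} (c : X → X) {x : X}
    (hx : x ∈ W) (i j : X) :
    #(oddLabels W c) ≤
      #(oddLabels (W.erase x) fun y => if y = x ∨ c y = j then i else c y) + 1 := by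
  set c' : X → X := fun y => if y = x ∨ c y = j then i else c y with hc'
  have hother : ∀ k, k ≠ i → k ≠ j → k ∈ oddLabels W c → k ∈ oddLabels (W.erase x) c' := by
    intro k hki hkj hk
    rw [mem_oddLabels] at hk ⊢
    convert hk using 2
    ext y
    simp only [hc', mem_erase, mem_filter, mem_univ, true_and]
    grind
  by_cases hi : i ∈ oddLabels W c
  · by_cases hj : j ∈ oddLabels W c
    · by_cases hij : i = j
      · refine (card_le_card (t := insert i (oddLabels (W.erase x) c')) ?_).trans
          (card_insert_le _ _)
        intro k hk
        rw [mem_insert]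
        by_cases hki : k = i
        · exact Or.inl hki
        · exact Or.inr (hother k hki (hij ▸ hki) hk)
      · have hi' : i ∈ oddLabels (W.erase x) c' := by
          rw [mem_oddLabels] at hi hj ⊢
          have : ({y | y ∉ W.erase x ∧ c' y = i} : Finset X) =
              insert x (({y | y ∉ W ∧ c y = i} : Finset X) ∪ ({y | y ∉ W ∧ c y = j} : Finset X)) := by
            ext y
            simp only [hc', mem_erase, mem_filter, mem_univ, true_and, mem_insert, mem_union]
            grind
          rw [this, card_insert_of_notMem (by simp [hx]), card_union_of_disjoint]
          · exact (hi.add_odd hj).add_one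
          · rw [Finset.disjoint_left]
            intro y
            simp only [mem_filter, mem_univ, true_and]
            grind
        refine (card_le_card (t := insert j (oddLabels (W.erase x) c')) ?_).trans
          (card_insert_le _ _)
        intro k hk
        rw [mem_insert]
        by_cases hki : k = i
        · exact Or.inr (hki ▸ hi')
        · by_cases hkj : k = j
          · exact Or.inl hkj
          · exact Or.inr (hother k hki hkj hk)
    · refine (card_le_card (t := insert i (oddLabels (W.erase x) c')) ?_).trans
        (card_insert_le _ _)
      intro k hk
      rw [mem_insert]
      by_cases hki : k = i
      · exact Or.inl hki
      · exact Or.inr (hother k hki (fun h => hj (h ▸ hk)) hk)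
  · refine (card_le_card (t := insert j (oddLabels (W.erase x) c')) ?_).trans
      (card_insert_le _ _)
    intro k hk
    rw [mem_insert]
    by_cases hkj : k = j
    · exact Or.inl hkj
    · exact Or.inr (hother k (fun h => hi (h ▸ hk)) hkj hk)

/-- A smallest violator of Tutte's condition in a graph of even order without perfect matching:
each of its vertices sees at least three labels (components) outside it. -/
lemma exists_minimal_violator (G : SimpleGraph X) (hX : Even (Fintype.card X))
    (h : ¬ ∃ M : G.Subgraph, M.IsPerfectMatching) :
    ∃ W : Finset X, ∃ c : X → X, (∀ x y, x ∉ W → y ∉ W → G.Adj x y → c x = c y) ∧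
      #W + 2 ≤ #(oddLabels W c) ∧
      ∀ x ∈ W, ∀ i j, ∃ y ∉ W, G.Adj x y ∧ c y ≠ i ∧ c y ≠ j := by
  obtain ⟨W, c, hc, hlt⟩ := exists_card_lt_card_oddLabels G h
  have hle : #W + 2 ≤ #(oddLabels W c) := by
    have := even_card_add_card_oddLabels W c hX
    rcases this with ⟨k, hk⟩
    omega
  clear hlt
  induction hN : #W using Nat.strong_induction_on generalizing W c with
  | _ N ih =>
    by_cases hmin : ∀ x ∈ W, ∀ i j, ∃ y ∉ W, G.Adj x y ∧ c y ≠ i ∧ c y ≠ j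
    · exact ⟨W, c, hc, hle, hmin⟩
    · push Not at hmin
      obtain ⟨x, hx, i, j, hij⟩ := hmin
      have hcard := card_erase_add_one hx
      refine ih #(W.erase x) (by omega) (W.erase x)
        (fun y => if y = x ∨ c y = j then i else c y) ?_ ?_ rfl
      · intro y z hy hz hyz
        have hc1 := hc y z
        have hx1 := hij z
        have hx2 := hij y
        have := hyz.ne
        have := hyz.symm
        simp only [mem_erase, not_and, ne_eq] at hy hz
        grind
      · have := card_oddLabels_le_card_oddLabels_erase_add_one c hx i j
        omega

end SimpleGraph

/-! ### Tutte's `r`-factor theorem for even `r` -/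

/-- A multigraph on `V` presented by its darts (half-edges): `base d` is the vertex at which the
dart `d` starts, and the fixed-point-free involution `mate` sends a dart to the opposite dart of the
same edge. -/
structure DartSystem (V D : Type*) where
  /-- The vertex of a dart. -/
  base : D → V
  /-- The other dart of the same edge. -/
  mate : D → D
  mate_mate : ∀ d, mate (mate d) = d
  mate_ne : ∀ d, mate d ≠ d

namespace DartSystem

variable {V D : Type*} (P : DartSystem V D)

/-- The gadget graph for `r`-factors: every vertex is replaced by `r` independent copies, each
joined to all darts at that vertex, and every dart is joined to its mate. In a perfect matching, the
edges whose darts are not matched to each other form an `r`-factor. -/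
def gadget (r : ℕ) : SimpleGraph ((V × Fin r) ⊕ D) where
  Adj
    | .inl a, .inr d => P.base d = a.1
    | .inr d, .inl a => P.base d = a.1
    | .inr d, .inr e => P.mate d = e
    | .inl _, .inl _ => False
  symm := ⟨by
    rintro (a | d) (b | e) h
    · exact h
    · exact h
    · exact h
    · change P.mate e = d
      rw [← h, P.mate_mate]⟩
  loopless := ⟨by
    rintro (a | d) h
    · exact h
    · exact P.mate_ne d h⟩

lemma gadget_adj_inl_inr {r : ℕ} {a : V × Fin r} {d : D} :
    (P.gadget r).Adj (.inl a) (.inr d) ↔ P.base d = a.1 := Iff.rfl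

lemma gadget_adj_inr_inl {r : ℕ} {a : V × Fin r} {d : D} :
    (P.gadget r).Adj (.inr d) (.inl a) ↔ P.base d = a.1 := Iff.rfl

lemma gadget_adj_inr_inr {r : ℕ} {d e : D} :
    (P.gadget r).Adj (.inr d) (.inr e) ↔ P.mate d = e := Iff.rfl

lemma not_gadget_adj_inl_inl {r : ℕ} {a b : V × Fin r} :
    ¬ (P.gadget r).Adj (.inl a) (.inl b) := id

lemma even_card_of_mate_mem (s : Finset D) (hs : ∀ d ∈ s, P.mate d ∈ s) : Even #s := by
  have h : ∑ _d ∈ s, (1 : ZMod 2) = 0 :=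
    sum_involution (fun d _ => P.mate d) (fun _ _ => by decide) (fun d _ _ => P.mate_ne d)
      hs (fun d _ => P.mate_mate d)
  rw [sum_const, nsmul_eq_mul, mul_one] at h
  exact (ZMod.natCast_eq_zero_iff_even).1 h

variable [Fintype D] [DecidableEq V]

/-- The number of darts at a vertex. -/
def degree (v : V) : ℕ := #{d | P.base d = v}

/-- The darts that start in `A` and whose mates start in `B`. -/
def dartsBetween (A B : Finset V) : Finset D := {d | P.base d ∈ A ∧ P.base (P.mate d) ∈ B}

lemma mem_dartsBetween {A B : Finset V} {d : D} :
    d ∈ P.dartsBetween A B ↔ P.base d ∈ A ∧ P.base (P.mate d) ∈ B := by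
  simp [dartsBetween]

lemma sum_degree (T : Finset V) : ∑ v ∈ T, P.degree v = #{d | P.base d ∈ T} := by
  rw [card_eq_sum_card_fiberwise (f := P.base) (t := T) (by intro d; simp)]
  refine sum_congr rfl fun v hv => congrArg card ?_
  ext d
  simp only [mem_filter, mem_univ, true_and]
  exact ⟨fun h => ⟨h ▸ hv, h⟩, fun h => h.2⟩

lemma exists_factor_of_isPerfectMatching [DecidableEq D] {r : ℕ} (M : (P.gadget r).Subgraph)
    (hM : M.IsPerfectMatching) :
    ∃ F : Finset D, (∀ d, P.mate d ∈ F ↔ d ∈ F) ∧ ∀ v, #{d ∈ F | P.base d = v} = r := by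
  classical
  rw [SimpleGraph.Subgraph.isPerfectMatching_iff] at hM
  have hk : ∀ a : V × Fin r, ∃ d, M.Adj (.inl a) (.inr d) := by
    intro a
    obtain ⟨x | d, hx, -⟩ := hM (.inl a)
    · exact (P.not_gadget_adj_inl_inl hx.adj_sub).elim
    · exact ⟨d, hx⟩
  choose k hk using hk
  refine ⟨({d | ¬ M.Adj (.inr d) (.inr (P.mate d))} : Finset D), ?_, ?_⟩
  · intro d
    simp only [mem_filter, mem_univ, true_and, P.mate_mate]
    rw [M.adj_comm]
  · intro v
    have hinj : Function.Injective fun i : Fin r => k (v, i) := by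
      intro i j hij
      have h1 := (hk (v, i)).symm
      have h2 := (hk (v, j)).symm
      simp only at hij
      rw [hij] at h1
      have := (hM _).unique h1 h2
      simpa using this
    have : ({d ∈ ({d | ¬ M.Adj (.inr d) (.inr (P.mate d))} : Finset D) | P.base d = v}) =
        univ.image fun i : Fin r => k (v, i) := by
      ext d
      simp only [mem_filter, mem_univ, true_and, mem_image]
      constructor
      · rintro ⟨hd, rfl⟩
        obtain ⟨⟨u, i⟩ | e, hx, -⟩ := hM (.inr d)
        · have hb : P.base d = u := P.gadget_adj_inr_inl.1 hx.adj_sub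
          refine ⟨i, ?_⟩
          subst hb
          have := (hM _).unique (hk (P.base d, i)) hx.symm
          simpa using this
        · have hb : P.mate d = e := P.gadget_adj_inr_inr.1 hx.adj_sub
          rw [hb] at hd
          exact (hd hx).elim
      · rintro ⟨i, rfl⟩
        refine ⟨fun h => ?_, P.gadget_adj_inl_inr.1 (hk (v, i)).adj_sub⟩
        have := (hM _).unique (hk (v, i)).symm h
        simp at this
    rw [this, card_image_of_injective _ hinj, card_univ, Fintype.card_fin]

/-- The darts leading to `T` from the vertices outside `S ∪ T` that carry the label `i`. -/
def dartsFromLabel {L : Type*} [DecidableEq L] (S T : Finset V) (c : V → L) (i : L) : Finset D :=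
  {d | P.base d ∉ S ∧ P.base d ∉ T ∧ c (P.base d) = i ∧ P.base (P.mate d) ∈ T}

lemma mem_dartsFromLabel {L : Type*} [DecidableEq L] {S T : Finset V} {c : V → L} {i : L} {d : D} :
    d ∈ P.dartsFromLabel S T c i ↔
      P.base d ∉ S ∧ P.base d ∉ T ∧ c (P.base d) = i ∧ P.base (P.mate d) ∈ T := by
  simp [dartsFromLabel]

/-- Tutte's `r`-factor theorem for even `r > 0`: if there is no `r`-factor, then there are disjoint
sets `S`, `T` that violate Tutte's inequality, even by `2`. The components of the multigraph
without `S ∪ T` enter as the classes of a labelling `c` that is constant along its edges. -/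
theorem exists_factor_or_exists_barrier [Fintype V] [DecidableEq D] {r : ℕ} (hr : Even r)
    (hr0 : 0 < r) (hdeg : ∀ v, ∃ d, P.base d = v) :
    (∃ F : Finset D, (∀ d, P.mate d ∈ F ↔ d ∈ F) ∧ ∀ v, #{d ∈ F | P.base d = v} = r) ∨
    ∃ (S T : Finset V) (c : V → (V × Fin r) ⊕ D), Disjoint S T ∧
      (∀ d, P.base d ∉ S → P.base d ∉ T → P.base (P.mate d) ∉ S → P.base (P.mate d) ∉ T →
        c (P.base d) = c (P.base (P.mate d))) ∧
      ∑ v ∈ T, P.degree v + r * #S + 2 ≤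
        r * #T + #(P.dartsBetween S T) + #{i | Odd #(P.dartsFromLabel S T c i)} := by
  by_cases hM : ∃ M : (P.gadget r).Subgraph, M.IsPerfectMatching
  · obtain ⟨M, hM⟩ := hM
    exact Or.inl (P.exists_factor_of_isPerfectMatching M hM)
  right
  have hX : Even (Fintype.card ((V × Fin r) ⊕ D)) := by
    rw [Fintype.card_sum, Fintype.card_prod, Fintype.card_fin]
    exact (hr.mul_left _).add (P.even_card_of_mate_mem univ (by simp))
  obtain ⟨W, c, hc, hle, hmin⟩ := SimpleGraph.exists_minimal_violator (P.gadget r) hX hM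
  -- By minimality, `W` contains all or none of the darts at a vertex, all or none of its copies,
  -- and never both a dart and a copy.
  have h1 : ∀ d e, P.base d = P.base e → .inr d ∈ W → .inr e ∈ W := by
    intro d e hde hd
    by_contra he
    obtain ⟨a | f, hy, hadj, hy1, hy2⟩ := hmin _ hd (c (.inr e)) (c (.inr (P.mate d)))
    · rw [gadget_adj_inr_inl, hde] at hadj
      exact hy1 (hc _ _ hy he (P.gadget_adj_inl_inr.2 hadj))
    · rw [gadget_adj_inr_inr] at hadj
      exact hy2 (by rw [hadj])
  have h2 : ∀ a b : V × Fin r, a.1 = b.1 → .inl a ∈ W → .inl b ∈ W := by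
    intro a b hab ha
    by_contra hb
    obtain ⟨b' | f, hy, hadj, hy1, -⟩ := hmin _ ha (c (.inl b)) (c (.inl b))
    · exact P.not_gadget_adj_inl_inl hadj
    · rw [gadget_adj_inl_inr, hab] at hadj
      exact hy1 (hc _ _ hy hb (P.gadget_adj_inr_inl.2 hadj))
  have h3 : ∀ (a : V × Fin r) d, P.base d = a.1 → .inl a ∈ W → .inr d ∉ W := by
    intro a d had ha hd
    obtain ⟨b | f, hy, hadj, hy1, -⟩ := hmin _ hd (c (.inr (P.mate d))) (c (.inr (P.mate d)))
    · rw [gadget_adj_inr_inl, had] at hadj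
      exact hy (h2 _ _ hadj ha)
    · rw [gadget_adj_inr_inr] at hadj
      exact hy1 (by rw [hadj])
  obtain ⟨S, hS'⟩ : ∃ S : Finset V, ∀ v, v ∈ S ↔ .inl (v, ⟨0, hr0⟩) ∈ W :=
    ⟨({v | .inl (v, ⟨0, hr0⟩) ∈ W} : Finset V), by simp⟩
  have hS : ∀ a : V × Fin r, .inl a ∈ W ↔ a.1 ∈ S := fun a =>
    (Iff.intro (h2 a (a.1, ⟨0, hr0⟩) rfl) (h2 _ _ rfl)).trans (hS' a.1).symm
  obtain ⟨T, hT'⟩ : ∃ T : Finset V, ∀ v, v ∈ T ↔ ∃ d, P.base d = v ∧ .inr d ∈ W := by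
    classical exact ⟨({v | ∃ d, P.base d = v ∧ .inr d ∈ W} : Finset V), by simp⟩
  have hT : ∀ d, .inr d ∈ W ↔ P.base d ∈ T := by
    intro d
    rw [hT']
    exact ⟨fun h => ⟨d, rfl, h⟩, fun ⟨e, he, heW⟩ => h1 _ _ he heW⟩
  have hST : Disjoint S T := by
    rw [Finset.disjoint_left]
    intro v hvS hvT
    obtain ⟨d, rfl, hd⟩ := (hT' v).1 hvT
    exact h3 _ d rfl ((hS' _).1 hvS) hd
  set lab : V → (V × Fin r) ⊕ D := fun v => c (.inl (v, ⟨0, hr0⟩)) with hlab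
  have hlab2 : ∀ d, P.base d ∉ S → P.base d ∉ T → c (.inr d) = lab (P.base d) := by
    intro d hdS hdT
    exact hc _ _ (by rwa [hT]) (by rwa [hS]) (P.gadget_adj_inr_inl.2 rfl)
  have hlab1 : ∀ a : V × Fin r, a.1 ∉ S → a.1 ∉ T → c (.inl a) = lab a.1 := by
    intro a haS haT
    obtain ⟨d, hd⟩ := hdeg a.1
    rw [← hd, ← hlab2 d (hd ▸ haS) (hd ▸ haT)]
    exact hc _ _ (by rwa [hS]) (by rwa [hT, hd]) (P.gadget_adj_inl_inr.2 hd)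
  have hmate : ∀ d, P.base d ∉ T → P.base (P.mate d) ∉ T →
      c (.inr d) = c (.inr (P.mate d)) := by
    intro d hd hd'
    exact hc _ _ (by rwa [hT]) (by rwa [hT]) (P.gadget_adj_inr_inr.2 rfl)
  refine ⟨S, T, lab, hST, ?_, ?_⟩
  · intro d hdS hdT hdS' hdT'
    rw [← hlab2 d hdS hdT, ← hlab2 _ hdS' hdT', hmate d hdT hdT']
  have hW : #W = r * #S + ∑ v ∈ T, P.degree v := by
    have : W = (S ×ˢ univ).disjSum ({d | P.base d ∈ T} : Finset D) := by
      ext (a | d)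
      · rw [inl_mem_disjSum, hS]; simp
      · rw [inr_mem_disjSum, hT]; simp
    rw [this, card_disjSum, card_product, card_univ, Fintype.card_fin, sum_degree, mul_comm]
  have hsub : SimpleGraph.oddLabels W c ⊆
      ((T ×ˢ (univ : Finset (Fin r))).image (fun a => c (.inl a)) ∪
        (P.dartsBetween S T).image (fun d => c (.inr d))) ∪
        ({i | Odd #(P.dartsFromLabel S T lab i)} : Finset ((V × Fin r) ⊕ D)) := by
    intro i hi
    rw [mem_union, or_iff_not_imp_left, mem_union, not_or]
    rintro ⟨hi1, hi2⟩
    simp only [mem_image, mem_product, mem_univ, and_true, not_exists, not_and] at hi1 hi2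
    rw [SimpleGraph.mem_oddLabels] at hi
    simp only [mem_filter, mem_univ, true_and]
    -- The class of `i` consists of all copies of some vertices, of pairs of mates, and of the darts
    -- leading from these vertices to `T`.
    have hclass : ({x | x ∉ W ∧ c x = i} : Finset ((V × Fin r) ⊕ D)) =
        (({v | v ∉ S ∧ v ∉ T ∧ lab v = i} : Finset V) ×ˢ (univ : Finset (Fin r))).disjSum
          ({d | P.base d ∉ T ∧ c (.inr d) = i} : Finset D) := by
      ext (a | d)
      · rw [inl_mem_disjSum]
        simp only [mem_filter, mem_univ, true_and, mem_product, and_true, hS]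
        constructor
        · rintro ⟨haS, hai⟩
          have haT : a.1 ∉ T := fun h => hi1 a h hai
          exact ⟨haS, haT, by rw [← hlab1 a haS haT, hai]⟩
        · rintro ⟨haS, haT, hai⟩
          exact ⟨haS, by rw [hlab1 a haS haT, hai]⟩
      · rw [inr_mem_disjSum]
        simp [hT]
    rw [hclass, card_disjSum, card_product, card_univ, Fintype.card_fin,
      ← card_filter_add_card_filter_not (s := ({d | P.base d ∉ T ∧ c (.inr d) = i} : Finset D))
        (fun d => P.base (P.mate d) ∈ T)] at hi
    have hpairs : Even #({d ∈ ({d | P.base d ∉ T ∧ c (.inr d) = i} : Finset D) |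
        P.base (P.mate d) ∉ T}) := by
      refine P.even_card_of_mate_mem _ fun d hd => ?_
      simp only [mem_filter, mem_univ, true_and, P.mate_mate] at hd ⊢
      exact ⟨⟨hd.2, by rw [← hmate d hd.1.1 hd.2, hd.1.2]⟩, hd.1.1⟩
    have hcross : ({d ∈ ({d | P.base d ∉ T ∧ c (.inr d) = i} : Finset D) |
        P.base (P.mate d) ∈ T}) = P.dartsFromLabel S T lab i := by
      ext d
      simp only [mem_filter, mem_univ, true_and, mem_dartsFromLabel]
      constructor
      · rintro ⟨⟨hdT, hdi⟩, hm⟩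
        have hdS : P.base d ∉ S := fun h => hi2 d (P.mem_dartsBetween.2 ⟨h, hm⟩) hdi
        exact ⟨hdS, hdT, by rw [← hlab2 d hdS hdT, hdi], hm⟩
      · rintro ⟨hdS, hdT, hdi, hm⟩
        exact ⟨⟨hdT, by rw [hlab2 d hdS hdT, hdi]⟩, hm⟩
    rw [hcross] at hi
    have he := hr.mul_left #({v | v ∉ S ∧ v ∉ T ∧ lab v = i} : Finset V)
    rw [Nat.odd_iff] at hi ⊢
    rw [Nat.even_iff] at he hpairs
    omega
  have hcard := card_le_card hsub
  have hu1 := card_union_le ((T ×ˢ (univ : Finset (Fin r))).image (fun a => c (.inl a)) ∪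
        (P.dartsBetween S T).image (fun d => c (.inr d)))
        ({i | Odd #(P.dartsFromLabel S T lab i)} : Finset ((V × Fin r) ⊕ D))
  have hu2 := card_union_le ((T ×ˢ (univ : Finset (Fin r))).image (fun a => c (.inl a)))
        ((P.dartsBetween S T).image (fun d => c (.inr d)))
  have hu3 : #((T ×ˢ (univ : Finset (Fin r))).image (fun a => c (.inl a))) ≤ r * #T := by
    refine card_image_le.trans ?_
    rw [card_product, card_univ, Fintype.card_fin, mul_comm]
  have hu4 := card_image_le (s := P.dartsBetween S T) (f := fun d => c (.inr d))
  omega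

end DartSystem

/-! ### Counting bounds for barriers -/

namespace DartSystem

variable {V D : Type*} (P : DartSystem V D) [Fintype D] [DecidableEq V]

lemma card_dartsBetween_le {l : ℕ} (hl : ∀ u v, #(P.dartsBetween {u} {v}) ≤ l)
    (A B : Finset V) : #(P.dartsBetween A B) ≤ l * #A * #B := by
  rw [mul_assoc, ← card_product]
  refine card_le_mul_card_image_of_maps_to (f := fun d => (P.base d, P.base (P.mate d))) ?_ l ?_
  · intro d hd
    rw [mem_dartsBetween] at hd
    exact mem_product.2 hd
  · rintro ⟨u, v⟩ -
    refine (card_le_card ?_).trans (hl u v)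
    intro d hd
    simp only [mem_filter, Prod.mk.injEq] at hd
    simp [mem_dartsBetween, hd.2.1, hd.2.2]

lemma degree_le_mul_card {l : ℕ} (hl : ∀ u v, #(P.dartsBetween {u} {v}) ≤ l) {v : V}
    (B : Finset V) (hB : ∀ d, P.base d = v → P.base (P.mate d) ∈ B) : P.degree v ≤ l * #B := by
  have h := P.card_dartsBetween_le hl {v} B
  rw [card_singleton, mul_one] at h
  refine (card_le_card ?_).trans h
  intro d hd
  simp only [mem_filter, mem_univ, true_and] at hd
  simp [mem_dartsBetween, hd, hB d hd]

lemma card_dartsBetween_le_sum_degree (A B : Finset V) :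
    #(P.dartsBetween A B) ≤ ∑ v ∈ A, P.degree v := by
  rw [sum_degree]
  refine card_le_card fun d hd => ?_
  rw [mem_dartsBetween] at hd
  simp [hd.1]

section Labels

variable {L : Type*} [DecidableEq L] {S T : Finset V} {c : V → L}

lemma exists_of_odd_card_dartsFromLabel {i : L} (hi : Odd #(P.dartsFromLabel S T c i)) :
    ∃ d, P.base d ∉ S ∧ P.base d ∉ T ∧ c (P.base d) = i ∧ P.base (P.mate d) ∈ T := by
  obtain ⟨d, hd⟩ := card_pos.1 hi.pos
  exact ⟨d, P.mem_dartsFromLabel.1 hd⟩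

lemma card_odd_add_card_dartsBetween_le [Fintype L] :
    #{i | Odd #(P.dartsFromLabel S T c i)} + #(P.dartsBetween S T) ≤ ∑ v ∈ T, P.degree v := by
  classical
  set R : Finset D := {d | P.base d ∉ S ∧ P.base d ∉ T ∧ P.base (P.mate d) ∈ T} with hR
  have h1 : #{i | Odd #(P.dartsFromLabel S T c i)} ≤ #R := by
    refine (card_le_card (t := R.image fun d => c (P.base d)) ?_).trans card_image_le
    intro i hi
    simp only [mem_filter, mem_univ, true_and] at hi
    obtain ⟨d, hd1, hd2, hd3, hd4⟩ := P.exists_of_odd_card_dartsFromLabel hi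
    exact mem_image.2 ⟨d, by simp [hR, hd1, hd2, hd4], hd3⟩
  have h2 : #R + #(P.dartsBetween S T) = #(R ∪ P.dartsBetween S T) := by
    rw [card_union_of_disjoint]
    rw [Finset.disjoint_left]
    intro d hd hd'
    rw [mem_dartsBetween] at hd'
    simp only [hR, mem_filter] at hd
    exact hd.2.1 hd'.1
  have h3 : #(R ∪ P.dartsBetween S T) ≤ #{d | P.base d ∈ T} := by
    refine card_le_card_of_injOn P.mate ?_ ?_
    · intro d hd
      simp only [hR, coe_union, Set.mem_union, mem_coe, mem_filter, mem_univ, true_and,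
        mem_dartsBetween] at hd
      simp only [mem_coe, mem_filter, mem_univ, true_and]
      tauto
    · intro d _ e _ hde
      rw [← P.mate_mate d, hde, P.mate_mate]
  rw [sum_degree]
  omega

/-- Every class of a labelling that is constant along the edges outside `S ∪ T` has, together with
`S ∪ T`, more than half of all vertices by the degree condition. As the odd classes are disjoint,
there are at most as many of them as vertices in `S ∪ T`. -/
lemma card_odd_le [Fintype L] [Fintype V] {l δ : ℕ} (hl0 : 0 < l)
    (hl : ∀ u v, #(P.dartsBetween {u} {v}) ≤ l) (hloop : ∀ d, P.base (P.mate d) ≠ P.base d)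
    (hδ : ∀ v, δ ≤ P.degree v) (hδn : l * Fintype.card V ≤ 2 * δ) (hST : Disjoint S T)
    (hc : ∀ d, P.base d ∉ S → P.base d ∉ T → P.base (P.mate d) ∉ S → P.base (P.mate d) ∉ T →
      c (P.base d) = c (P.base (P.mate d))) :
    #{i | Odd #(P.dartsFromLabel S T c i)} + #S + #T ≤ Fintype.card V ∧
      (1 ≤ #T → #{i | Odd #(P.dartsFromLabel S T c i)} ≤ #S + #T) := by
  set Q : Finset L := {i | Odd #(P.dartsFromLabel S T c i)} with hQ
  have hcompl : #((S ∪ T)ᶜ) + #S + #T = Fintype.card V := by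
    have := card_add_card_compl (S ∪ T)
    rw [card_union_of_disjoint hST] at this
    omega
  have hmem : ∀ i ∈ Q, ∃ v ∈ (S ∪ T)ᶜ, c v = i := by
    intro i hi
    simp only [hQ, mem_filter, mem_univ, true_and] at hi
    obtain ⟨d, hd1, hd2, hd3, -⟩ := P.exists_of_odd_card_dartsFromLabel hi
    exact ⟨P.base d, by simp [hd1, hd2], hd3⟩
  have hQle : #Q ≤ #((S ∪ T)ᶜ) := by
    refine (card_le_card (t := ((S ∪ T)ᶜ).image c) fun i hi => ?_).trans card_image_le
    exact mem_image.2 (hmem i hi)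
  refine ⟨by omega, fun hT => ?_⟩
  rcases Q.eq_empty_or_nonempty with hQe | hQne
  · rw [hQe]; simp
  obtain ⟨i, hi, hmin⟩ := exists_min_image Q (fun i => #{v ∈ (S ∪ T)ᶜ | c v = i}) hQne
  obtain ⟨v, hv, hvi⟩ := hmem i hi
  have hsum : #Q * #{v ∈ (S ∪ T)ᶜ | c v = i} ≤ #((S ∪ T)ᶜ) := by
    rw [← smul_eq_mul, ← sum_const]
    refine (sum_le_sum hmin).trans ?_
    refine (sum_le_sum_of_subset (subset_univ Q)).trans ?_
    rw [← card_eq_sum_card_fiberwise (f := c) (t := univ) (by simp)]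
  have hvmem : v ∈ ({v ∈ (S ∪ T)ᶜ | c v = i} : Finset V) := mem_filter.2 ⟨hv, hvi⟩
  have hdeg := P.degree_le_mul_card hl (v := v)
    ((({v ∈ (S ∪ T)ᶜ | c v = i} : Finset V).erase v) ∪ (S ∪ T)) (by
      rintro d rfl
      by_cases hm : P.base (P.mate d) ∈ S ∪ T
      · exact mem_union_right _ hm
      · refine mem_union_left _ (mem_erase.2 ⟨hloop d, mem_filter.2 ⟨mem_compl.2 hm, ?_⟩⟩)
        simp only [mem_compl, mem_union, not_or] at hv hm
        rw [← hc d hv.1 hv.2 hm.1 hm.2, hvi])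
  have hcard : #((({v ∈ (S ∪ T)ᶜ | c v = i} : Finset V).erase v) ∪ (S ∪ T)) ≤
      #(({v ∈ (S ∪ T)ᶜ | c v = i} : Finset V).erase v) + (#S + #T) :=
    (card_union_le _ _).trans (Nat.add_le_add_left (card_union_le _ _) _)
  have herase := card_erase_add_one hvmem
  set k := #(({v ∈ (S ∪ T)ᶜ | c v = i} : Finset V).erase v)
  rw [← herase] at hsum
  have hn : Fintype.card V ≤ 2 * (k + (#S + #T)) := by
    refine Nat.le_of_mul_le_mul_left ?_ hl0
    calc l * Fintype.card V ≤ 2 * δ := hδn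
      _ ≤ 2 * (l * (k + (#S + #T))) :=
        Nat.mul_le_mul_left _ ((hδ v).trans (hdeg.trans (Nat.mul_le_mul_left _ hcard)))
      _ = l * (2 * (k + (#S + #T))) := by ring
  by_contra! hlt
  have hQ2 : 2 ≤ #Q := by omega
  obtain ⟨q, hq⟩ := Nat.exists_eq_add_of_le hQ2
  rw [hq] at hsum hlt
  have : (2 + q) * (k + 1) = 2 * k + 2 + q + q * k := by ring
  have := Nat.zero_le (q * k)
  omega

end Labels

/-- Reduction of the existence of an `r`-factor to arithmetic: a barrier would have sizes
`s = |S|`, `t = |T|`, `q` odd classes, degree sum `a` over `T` and `e` edges between `S` and `T`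
that satisfy all the counting bounds, and also violate Tutte's inequality. -/
theorem exists_factor_of_counts [Fintype V] [DecidableEq D] {n l δ Δ r : ℕ}
    (hn : Fintype.card V = n) (hl0 : 0 < l) (hl : ∀ u v, #(P.dartsBetween {u} {v}) ≤ l)
    (hloop : ∀ d, P.base (P.mate d) ≠ P.base d) (hδ : ∀ v, δ ≤ P.degree v)
    (hΔ : ∀ v, P.degree v ≤ Δ) (hδn : l * n ≤ 2 * δ) (hr : Even r) (hr0 : 0 < r)
    (h : ∀ s t q a e : ℕ, t * δ ≤ a → e ≤ l * s * t → e ≤ s * Δ → q + e ≤ a → q + s + t ≤ n →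
      (1 ≤ t → q ≤ s + t) → r * t + e + q < a + r * s + 2) :
    ∃ F : Finset D, (∀ d, P.mate d ∈ F ↔ d ∈ F) ∧ ∀ v, #{d ∈ F | P.base d = v} = r := by
  subst hn
  have hdeg : ∀ v, ∃ d, P.base d = v := by
    intro v
    have hV : 0 < Fintype.card V := Fintype.card_pos_iff.2 ⟨v⟩
    have h1 : 0 < P.degree v := by
      have := hδ v
      have := Nat.mul_pos hl0 hV
      omega
    obtain ⟨d, hd⟩ := card_pos.1 h1
    exact ⟨d, by simpa using hd⟩
  rcases P.exists_factor_or_exists_barrier hr hr0 hdeg with hF | ⟨S, T, c, hST, hc, hbar⟩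
  · exact hF
  · obtain ⟨hq1, hq2⟩ := P.card_odd_le hl0 hl hloop hδ hδn hST hc
    have := h #S #T _ _ _ ?_ (P.card_dartsBetween_le hl S T) ?_
      (P.card_odd_add_card_dartsBetween_le (c := c)) hq1 hq2
    · omega
    · rw [← smul_eq_mul]
      exact card_nsmul_le_sum _ _ _ fun v _ => hδ v
    · refine (P.card_dartsBetween_le_sum_degree S T).trans ?_
      rw [← smul_eq_mul]
      exact sum_le_card_nsmul _ _ _ fun v _ => hΔ v

end DartSystem

/-! ### Tutte's inequality -/

/-- The case `T = V \ S` of Tutte's inequality, with `s = |S|`: the bound on `r` says that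
`(n - s) * (δ - l * s) - r * (n - 2 * s)`, a quadratic polynomial in `s`, has non-positive
discriminant. For `2 * r < δ` the discriminant may be positive, but then `r` may be raised to `δ / 2`
because `2 * s ≤ n`. -/
lemma mul_sub_le_of_le_add_sqrt {n l δ r s : ℝ} (hl0 : 0 < l) (hδ : l * n / 2 ≤ δ) (hn : 0 ≤ n)
    (hs : 2 * s ≤ n) (hr : r ≤ (δ + √(l * n * (2 * δ - l * n))) / 2) :
    r * (n - 2 * s) ≤ (n - s) * (δ - l * s) := by
  rcases le_total (2 * r) δ with h | h
  · have h1 : r * (n - 2 * s) ≤ δ / 2 * (n - 2 * s) :=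
      mul_le_mul_of_nonneg_right (by linarith) (by linarith)
    have h2 : 0 ≤ (n / 2) * (δ - l * n / 2) := mul_nonneg (by linarith) (by linarith)
    have h3 : 0 ≤ l * (n / 2 - s) ^ 2 := mul_nonneg hl0.le (sq_nonneg _)
    nlinarith
  · have h0 : 0 ≤ l * n * (2 * δ - l * n) :=
      mul_nonneg (mul_nonneg hl0.le hn) (by linarith)
    have h1 : (2 * r - δ) ^ 2 ≤ l * n * (2 * δ - l * n) := by
      rw [← Real.sq_sqrt h0]
      exact pow_le_pow_left₀ (by linarith) (by linarith) 2
    refine le_of_mul_le_mul_left ?_ hl0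
    nlinarith [sq_nonneg (2 * (l * s) - (l * n + δ - 2 * r))]

lemma lt_of_le_add_sqrt {n l δ r : ℝ} (hl0 : 0 < l) (hn : 0 ≤ n) (hδ : l * n / 2 ≤ δ)
    (hδ' : δ + l ≤ l * n) (hr : r ≤ (δ + √(l * n * (2 * δ - l * n))) / 2) : r < δ := by
  have h0 : 0 ≤ l * n * (2 * δ - l * n) := mul_nonneg (mul_nonneg hl0.le hn) (by linarith)
  have hδ0 : 0 < δ := by linarith
  have : √(l * n * (2 * δ - l * n)) < δ := by
    rw [Real.sqrt_lt' hδ0]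
    nlinarith [pow_pos hl0 2]
  linarith

/-- Tutte's inequality under the bound `r ≤ (δ + √(ln(2δ - ln))) / 2`. -/
lemma tutte_inequality_of_le_add_sqrt {n l δ r s t q a e : ℕ} (hl0 : 0 < l) (hr0 : 2 ≤ r)
    (hδ : (l * n / 2 : ℝ) ≤ δ) (hδ' : δ + l ≤ l * n)
    (hr : (r : ℝ) ≤ (δ + √(l * n * (2 * δ - l * n))) / 2)
    (ha : t * δ ≤ a) (he : e ≤ l * s * t) (hqa : q + e ≤ a) (hq : q + s + t ≤ n)
    (hq' : 1 ≤ t → q ≤ s + t) : r * t + e + q < a + r * s + 2 := by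
  have hl0' : (0 : ℝ) < l := by exact_mod_cast hl0
  have hrδ : r < δ := by
    have := lt_of_le_add_sqrt (n := n) hl0' (by positivity) hδ (by exact_mod_cast hδ') hr
    exact_mod_cast this
  rcases le_or_gt t s with hts | hts
  · have := Nat.mul_le_mul_left r hts
    omega
  have hq'' := hq' (by omega)
  have hquad : (r : ℤ) * (n - 2 * s) ≤ (n - s) * (δ - l * s) := by
    have h2s : (2 * s : ℝ) ≤ n := by
      have : 2 * s ≤ n := by omega
      exact_mod_cast this
    have := mul_sub_le_of_le_add_sqrt hl0' hδ (by positivity) h2s hr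
    exact_mod_cast this
  have hδZ : (l * n : ℤ) ≤ 2 * δ := by
    have : (l * n : ℝ) ≤ 2 * δ := by linarith
    exact_mod_cast this
  zify at *
  rcases lt_trichotomy (δ : ℤ) (l * s + r) with h | h | h
  · -- Tutte's expression decreases by at least `1` whenever `t` grows by `1`. Raising `t` to `n - s`
    -- therefore costs at least `n - s - t ≥ q`.
    nlinarith [mul_nonneg (show (0 : ℤ) ≤ n - s - t by omega)
      (show (0 : ℤ) ≤ l * s + r - δ - 1 by omega)]
  · -- Here `q ≤ n - s - t` and `q ≤ s + t` average to `q ≤ s + r`.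
    have hs1 : (1 : ℤ) ≤ s := by
      by_contra hs
      have : (s : ℤ) = 0 := by omega
      rw [this] at h
      omega
    have h1 : (n : ℤ) ≤ 2 * s + 2 * r := by
      by_contra! hlt
      nlinarith [mul_le_mul_of_nonneg_left hlt.le hl0.le]
    nlinarith [mul_nonneg (show (0 : ℤ) ≤ s - 1 by omega) (show (0 : ℤ) ≤ r - 1 by omega)]
  · -- Tutte's expression without `q` is at least `t + r * s ≥ s + t`.
    nlinarith [mul_nonneg (show (0 : ℤ) ≤ t by omega) (show (0 : ℤ) ≤ δ - l * s - r - 1 by omega),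
      mul_nonneg (show (0 : ℤ) ≤ s by omega) (show (0 : ℤ) ≤ r - 1 by omega)]

/-- Tutte's inequality for almost regular multigraphs. -/
lemma tutte_inequality_of_almost_regular {ξ : ℝ} (hξ0 : 0 < ξ) (hξ : ξ < 1 / 9)
    {n l δ Δ r s t q a e : ℕ} (hl0 : 0 < l) (hn : 5 / ξ ^ 2 ≤ n)
    (hΔ : (1 / 2 + ξ) * l * n ≤ Δ) (hΔδ : (Δ : ℝ) ≤ δ + ξ ^ 2 * l * n)
    (hr : (r : ℝ) ≤ δ - ξ * l * n)
    (ha : t * δ ≤ a) (he : e ≤ l * s * t) (he' : e ≤ s * Δ) (hqa : q + e ≤ a)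
    (hq : q + s + t ≤ n) (hq' : 1 ≤ t → q ≤ s + t) : r * t + e + q < a + r * s + 2 := by
  rcases le_or_gt t s with hts | hts
  · have := Nat.mul_le_mul_left r hts
    omega
  have hq'' := hq' (by omega)
  by_contra! hcon
  have hl1 : (1 : ℝ) ≤ l := by exact_mod_cast hl0
  have hts' : (s + 1 : ℝ) ≤ t := by exact_mod_cast hts
  have hn' : 5 ≤ ξ ^ 2 * n := by
    rw [div_le_iff₀ (by positivity)] at hn
    linarith
  have hn0 : (0 : ℝ) ≤ n := by positivity
  have hN : (n : ℝ) ≤ l * n := le_mul_of_one_le_left hn0 hl1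
  have ha' : (t * δ : ℝ) ≤ a := by exact_mod_cast ha
  have heR : (e : ℝ) ≤ l * s * t := by exact_mod_cast he
  have heR' : (e : ℝ) ≤ s * Δ := by exact_mod_cast he'
  have hqR : (q + s + t : ℝ) ≤ n := by exact_mod_cast hq
  have hqR' : (q : ℝ) ≤ s + t := by exact_mod_cast hq''
  have hconR : (a + r * s + 2 : ℝ) ≤ r * t + e + q := by exact_mod_cast hcon
  have hs0 : (0 : ℝ) ≤ s := by positivity
  have hq0 : (0 : ℝ) ≤ q := by positivity
  have hrts : (r * (t - s) : ℝ) ≤ (δ - ξ * l * n) * (t - s) :=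
    mul_le_mul_of_nonneg_right hr (by linarith)
  have hδ : (1 / 2 + ξ - ξ ^ 2) * (l * n) ≤ δ := by linarith
  rcases le_or_gt (l * t : ℝ) δ with h | h
  · -- The multiplicity bound on `e` is used; if `t - s` and `s` are both `O(1 / ξ)`, then so is `q`.
    have h1 : (t - s) * (ξ * (l * n)) + s * (δ - l * t) + 2 ≤ q := by linarith
    have h2 : (0 : ℝ) ≤ s * (δ - l * t) := mul_nonneg hs0 (by linarith)
    rcases le_or_gt 1 (ξ * (t - s)) with hb | hb
    · have : (1 : ℝ) * (l * n) ≤ (ξ * (t - s)) * (l * n) :=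
        mul_le_mul_of_nonneg_right hb (by positivity)
      linarith
    · -- Now `t` is close to `s`, so that `t` is at most about `n / 2`.
      have h3 : ξ * (l * n) / 2 ≤ δ - l * t := by
        have h4 : ξ * (q + s + t) ≤ ξ * n := mul_le_mul_of_nonneg_left hqR hξ0.le
        have h5 : 0 ≤ ξ * q := by positivity
        have h6 : l * (ξ * (2 * t)) ≤ l * (ξ * n + 1) :=
          mul_le_mul_of_nonneg_left (by linarith) (by linarith)
        have h7 : l * 5 ≤ l * (ξ ^ 2 * n) := mul_le_mul_of_nonneg_left hn' (by linarith)
        have h8 : ξ * (ξ ^ 2 * (l * n)) ≤ 1 / 9 * (ξ ^ 2 * (l * n)) :=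
          mul_le_mul_of_nonneg_right hξ.le (by positivity)
        have h9 := mul_le_mul_of_nonneg_left hδ hξ0.le
        refine le_of_mul_le_mul_left ?_ hξ0
        linarith
      have h4 : s * (ξ * n / 2) ≤ s * (δ - l * t) := by
        refine mul_le_mul_of_nonneg_left (le_trans ?_ h3) hs0
        have : ξ * n ≤ ξ * (l * n) := mul_le_mul_of_nonneg_left hN hξ0.le
        linarith
      have h5 : 0 ≤ (t - s) * (ξ * (l * n)) := mul_nonneg (by linarith) (by positivity)
      have h6 : s * ξ < 2 := by
        by_contra! hge
        have := mul_le_mul_of_nonneg_right hge hn0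
        linarith
      have h7 : ξ * q ≤ ξ * (s + t) := mul_le_mul_of_nonneg_left hqR' hξ0.le
      have h8 : ξ * n ≤ ξ * (l * n) := mul_le_mul_of_nonneg_left hN hξ0.le
      have h9 : ξ * (l * n) ≤ (t - s) * (ξ * (l * n)) :=
        le_mul_of_one_le_left (by positivity) (by linarith)
      have h10 : ξ * (ξ * n) ≤ ξ * q := mul_le_mul_of_nonneg_left (by linarith) hξ0.le
      linarith
  · -- Here `t` exceeds `n / 2`, so that `t - s` is of order `ξ * n`, and the degree bound
    -- `e ≤ s * Δ` suffices.
    have h1 : (t - s) * (ξ * (l * n)) + 2 ≤ s * (ξ ^ 2 * (l * n)) + q := by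
      have : (s * Δ : ℝ) ≤ s * (δ + ξ ^ 2 * l * n) := mul_le_mul_of_nonneg_left hΔδ hs0
      linarith
    have h2 : (1 / 2 + ξ - ξ ^ 2) * n ≤ t := by
      refine le_of_mul_le_mul_left (a := (l : ℝ)) ?_ (by linarith)
      linarith
    have h3 : 2 * (ξ - ξ ^ 2) * n ≤ t - s := by linarith
    have h4 : (s : ℝ) ≤ n / 2 := by linarith
    have h5 : 2 * (ξ - ξ ^ 2) * n * (ξ * (l * n)) ≤ (t - s) * (ξ * (l * n)) :=
      mul_le_mul_of_nonneg_right h3 (by positivity)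
    have h6 : s * (ξ ^ 2 * (l * n)) ≤ n / 2 * (ξ ^ 2 * (l * n)) :=
      mul_le_mul_of_nonneg_right h4 (by positivity)
    have h7 : 5 * (l * n) ≤ ξ ^ 2 * n * (l * n) := mul_le_mul_of_nonneg_right hn' (by positivity)
    have h8 : ξ * (ξ ^ 2 * n * (l * n)) ≤ 1 / 9 * (ξ ^ 2 * n * (l * n)) :=
      mul_le_mul_of_nonneg_right hξ.le (by positivity)
    linarith

/-! ### Multigraphs as dart systems -/

namespace Graph

variable {α β : Type*} (G : Graph α β)

lemma finite_darts [Finite G.vertexSet] {l : ℕ} (hl : G.MultiplicityLE l) :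
    Finite {p : β × G.vertexSet // G.Inc p.1 p.2} := by
  have hE : (⋃ x : G.vertexSet, ⋃ y : G.vertexSet, {e | G.IsLink e x y}).Finite :=
    Set.finite_iUnion fun x => Set.finite_iUnion fun y =>
      Set.finite_of_encard_le_coe (hl x y)
  have : Finite ↥(⋃ x : G.vertexSet, ⋃ y : G.vertexSet, {e | G.IsLink e x y}) := hE
  refine Finite.of_injective (β := ↥(⋃ x : G.vertexSet, ⋃ y : G.vertexSet,
    {e | G.IsLink e x y}) × G.vertexSet) (fun d => (⟨d.1.1, ?_⟩, d.1.2)) ?_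
  · refine Set.mem_iUnion.2 ⟨d.1.2, Set.mem_iUnion.2 ⟨⟨d.2.other, d.2.inc_other.vertex_mem⟩, ?_⟩⟩
    exact d.2.isLink_other
  · rintro ⟨⟨e, x⟩, h⟩ ⟨⟨f, y⟩, h'⟩ heq
    simp only [Prod.mk.injEq, Subtype.mk.injEq] at heq
    exact Subtype.ext (Prod.ext heq.1 heq.2)

lemma minDegree_le_degree {x : α} (hx : x ∈ G.vertexSet) : G.minDegree ≤ G.degree x :=
  Nat.sInf_le ⟨x, hx, rfl⟩

lemma degree_le_maxDegree (hV : G.vertexSet.Finite) {x : α} (hx : x ∈ G.vertexSet) :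
    G.degree x ≤ G.maxDegree :=
  le_csSup (hV.image _).bddAbove ⟨x, hx, rfl⟩

lemma isFactor_noEdge_zero : (noEdge G.vertexSet β).IsFactor G 0 := by
  refine ⟨⟨⟨subset_rfl, ?_⟩, rfl⟩, ?_⟩
  · intro e x y h
    simp at h
  · intro x _
    have h1 : (noEdge G.vertexSet β).incidenceSet x = ∅ := by
      ext e; simp
    have h2 := (noEdge G.vertexSet β).loopSet_subset_incidenceSet x
    rw [h1, Set.subset_empty_iff] at h2
    rw [degree, h1, h2, Set.ncard_empty]

/-- The darts of a loopless multigraph: pairs of an edge and one of its ends. -/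
noncomputable def dartSystem [G.Loopless] :
    DartSystem G.vertexSet {p : β × G.vertexSet // G.Inc p.1 p.2} where
  base d := d.1.2
  mate d := ⟨(d.1.1, ⟨d.2.other, d.2.inc_other.vertex_mem⟩), d.2.inc_other⟩
  mate_mate := by
    rintro ⟨⟨e, x⟩, h⟩
    refine Subtype.ext (Prod.ext rfl (Subtype.ext ?_))
    exact h.inc_other.isLink_other.right_unique h.isLink_other.symm
  mate_ne := by
    rintro ⟨⟨e, x⟩, h⟩ heq
    have : h.other = x := congrArg (fun d => (d.1.2 : α)) heq
    exact h.isLink_other.ne this.symm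

variable [G.Loopless]

lemma dartSystem_isLink (d) :
    G.IsLink d.1.1 (G.dartSystem.base d) (G.dartSystem.base (G.dartSystem.mate d)) :=
  d.2.isLink_other

lemma degree_eq_ncard (x : α) : G.degree x = {e | G.Inc e x}.ncard := by
  have : G.loopSet x = ∅ := by
    ext e; simp
  rw [degree, this, Set.ncard_empty, add_zero, incidenceSet]

lemma card_eq_ncard_edges {v : G.vertexSet} (F : Finset {p : β × G.vertexSet // G.Inc p.1 p.2})
    (hF : ∀ d ∈ F, G.dartSystem.base d = v) : #F = {e | ∃ d ∈ F, d.1.1 = e}.ncard := by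
  rw [← Set.ncard_coe_finset, ← Set.InjOn.ncard_image (f := fun d => d.1.1)]
  · rfl
  · intro d hd d' hd' heq
    exact Subtype.ext (Prod.ext heq ((hF d hd).trans (hF d' hd').symm))

lemma degree_dartSystem [Fintype {p : β × G.vertexSet // G.Inc p.1 p.2}]
    [DecidableEq G.vertexSet] (v : G.vertexSet) : G.dartSystem.degree v = G.degree v := by
  rw [degree_eq_ncard, DartSystem.degree,
    G.card_eq_ncard_edges (v := v) _ fun d hd => (mem_filter.1 hd).2]
  congr 1
  ext e
  simp only [mem_filter, mem_univ, true_and, Set.mem_ofPred_eq]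
  constructor
  · rintro ⟨⟨⟨f, x⟩, h⟩, rfl, rfl⟩
    exact h
  · intro h
    exact ⟨⟨(e, v), h⟩, rfl, rfl⟩

lemma card_dartsBetween_singleton_le [Fintype {p : β × G.vertexSet // G.Inc p.1 p.2}]
    [DecidableEq G.vertexSet] {l : ℕ} (hl : G.MultiplicityLE l) (u v : G.vertexSet) :
    #(G.dartSystem.dartsBetween {u} {v}) ≤ l := by
  have h : ((#(G.dartSystem.dartsBetween {u} {v}) : ℕ) : ℕ∞) ≤ l := by
    refine le_trans ?_ (hl u v)
    rw [← Set.encard_coe_eq_coe_finsetCard]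
    refine Set.encard_le_encard_of_injOn (f := fun d => d.1.1) ?_ ?_
    · intro d hd
      rw [mem_coe, DartSystem.mem_dartsBetween, mem_singleton, mem_singleton] at hd
      have := G.dartSystem_isLink d
      rwa [hd.1, hd.2] at this
    · intro d hd d' hd' heq
      rw [mem_coe, DartSystem.mem_dartsBetween, mem_singleton, mem_singleton] at hd hd'
      exact Subtype.ext (Prod.ext heq (hd.1.trans hd'.1.symm))
  exact_mod_cast h

lemma minDegree_add_le {n l : ℕ} (hV : G.vertexSet.Finite) (hn : G.vertexSet.ncard = n)
    (hn0 : 0 < n) (hl : G.MultiplicityLE l) : G.minDegree + l ≤ l * n := by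
  classical
  have : Finite G.vertexSet := hV
  have : Fintype G.vertexSet := Fintype.ofFinite _
  have := G.finite_darts hl
  have : Fintype {p : β × G.vertexSet // G.Inc p.1 p.2} := Fintype.ofFinite _
  obtain ⟨x, hx⟩ : G.vertexSet.Nonempty := by
    rw [← Set.ncard_pos hV]; omega
  have hcard : Fintype.card G.vertexSet = n := by
    rw [← hn, ← Nat.card_coe_set_eq, Nat.card_eq_fintype_card]
  have h1 := G.dartSystem.degree_le_mul_card (G.card_dartsBetween_singleton_le hl) (v := ⟨x, hx⟩)
    (univ.erase ⟨x, hx⟩) (by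
      rintro d hd
      rw [← hd]
      refine mem_erase.2 ⟨fun h => ?_, mem_univ _⟩
      exact (G.dartSystem_isLink d).ne (congrArg Subtype.val h).symm)
  rw [degree_dartSystem, card_erase_of_mem (mem_univ _), card_univ, hcard] at h1
  have h2 := G.minDegree_le_degree hx
  obtain ⟨k, rfl⟩ := Nat.exists_eq_succ_of_ne_zero hn0.ne'
  simp only [Nat.succ_eq_add_one, Nat.add_sub_cancel, mul_add, mul_one] at h1 ⊢
  exact Nat.add_le_add_right (h2.trans h1) _

/-- A set of darts closed under taking mates and containing `r` darts at each vertex is the dart set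
of an `r`-factor. -/
lemma exists_isFactor_of_darts [Fintype {p : β × G.vertexSet // G.Inc p.1 p.2}]
    [DecidableEq G.vertexSet] {r : ℕ} (F : Finset {p : β × G.vertexSet // G.Inc p.1 p.2})
    (hF : ∀ d, G.dartSystem.mate d ∈ F ↔ d ∈ F)
    (hr : ∀ v, #{d ∈ F | G.dartSystem.base d = v} = r) : ∃ H : Graph α β, H.IsFactor G r := by
  have hmem : ∀ d d' : {p : β × G.vertexSet // G.Inc p.1 p.2}, d.1.1 = d'.1.1 → d ∈ F →
      d' ∈ F := by
    intro d d' hdd hd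
    have h := d'.2
    rw [← hdd] at h
    rcases h.eq_or_eq_of_isLink (G.dartSystem_isLink d) with h | h
    · have : d' = d := Subtype.ext (Prod.ext hdd.symm (Subtype.ext h))
      rwa [this]
    · have : d' = G.dartSystem.mate d := Subtype.ext (Prod.ext hdd.symm (Subtype.ext h))
      rwa [this, hF]
  refine ⟨G.restrict {e | ∃ d ∈ F, d.1.1 = e}, ⟨restrict_le, rfl⟩, ?_⟩
  intro x hx
  have hx' : x ∈ G.vertexSet := hx
  have : (G.restrict {e | ∃ d ∈ F, d.1.1 = e}).Loopless := ‹G.Loopless›.anti restrict_le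
  rw [degree_eq_ncard, ← hr ⟨x, hx'⟩,
    G.card_eq_ncard_edges (v := ⟨x, hx'⟩) _ fun d hd => (mem_filter.1 hd).2]
  congr 1
  ext e
  simp only [restrict_inc, mem_filter, Set.mem_ofPred_eq]
  constructor
  · rintro ⟨h, d, hd, rfl⟩
    exact ⟨⟨(d.1.1, ⟨x, hx'⟩), h⟩, ⟨hmem d _ rfl hd, rfl⟩, rfl⟩
  · rintro ⟨d, ⟨hd, hdx⟩, rfl⟩
    refine ⟨?_, d, hd, rfl⟩
    have := (G.dartSystem_isLink d).inc_left
    rwa [hdx] at this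

/-- `DartSystem.exists_factor_of_counts` for multigraphs. -/
theorem exists_isFactor_of_counts {n l r : ℕ} (hV : G.vertexSet.Finite)
    (hn : G.vertexSet.ncard = n) (hl : G.MultiplicityLE l) (hl0 : 0 < l)
    (hδ : (l * n / 2 : ℝ) ≤ G.minDegree) (hr : Even r) (hr0 : 0 < r)
    (h : ∀ s t q a e : ℕ, t * G.minDegree ≤ a → e ≤ l * s * t → e ≤ s * G.maxDegree →
      q + e ≤ a → q + s + t ≤ n → (1 ≤ t → q ≤ s + t) → r * t + e + q < a + r * s + 2) :
    ∃ H : Graph α β, H.IsFactor G r := by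
  classical
  have : Finite G.vertexSet := hV
  have : Fintype G.vertexSet := Fintype.ofFinite _
  have := G.finite_darts hl
  have : Fintype {p : β × G.vertexSet // G.Inc p.1 p.2} := Fintype.ofFinite _
  have hcard : Fintype.card G.vertexSet = n := by
    rw [← hn, ← Nat.card_coe_set_eq, Nat.card_eq_fintype_card]
  have hδn : l * n ≤ 2 * G.minDegree := by
    have : (l * n : ℝ) ≤ 2 * G.minDegree := by linarith
    exact_mod_cast this
  obtain ⟨F, hF, hFr⟩ := G.dartSystem.exists_factor_of_counts hcard hl0
    (G.card_dartsBetween_singleton_le hl)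
    (fun d hd => (G.dartSystem_isLink d).ne (congrArg Subtype.val hd).symm)
    (fun v => by rw [degree_dartSystem]; exact G.minDegree_le_degree v.2)
    (fun v => by rw [degree_dartSystem]; exact G.degree_le_maxDegree hV v.2) hδn hr hr0 h
  exact G.exists_isFactor_of_darts F hF hFr

end Graph

end

/-! ### Existence of even factors -/

theorem mainTheorem5 :
    (∀ {α : Type*} {β : Type*} (G : Graph α β) (n l : ℕ),
      G.vertexSet.Finite → G.vertexSet.ncard = n → G.Loopless → G.MultiplicityLE l →
      (l * n / 2 : ℝ) ≤ G.minDegree →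
      ∀ r : ℕ, Even r →
        (r : ℝ) ≤ (G.minDegree + √(l * n * (2 * G.minDegree - l * n))) / 2 →
        ∃ H : Graph α β, H.IsFactor G r) ∧
    (∀ ξ : ℝ, 0 < ξ → ξ < 1 / 9 → ∃ n₀ : ℕ,
      ∀ {α : Type*} {β : Type*} (G : Graph α β) (n l : ℕ), n₀ ≤ n →
        G.vertexSet.Finite → G.vertexSet.ncard = n → G.Loopless → G.MultiplicityLE l →
        (l * n / 2 : ℝ) ≤ G.minDegree →
        (1 / 2 + ξ) * l * n ≤ G.maxDegree →
        (G.maxDegree : ℝ) ≤ G.minDegree + ξ ^ 2 * l * n →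
        ∀ r : ℕ, Even r → (r : ℝ) ≤ G.minDegree - ξ * l * n →
          ∃ H : Graph α β, H.IsFactor G r) := by
  constructor
  · intro α β G n l hV hn hG hl hδ r hr hrle
    rcases Nat.eq_zero_or_pos r with rfl | hr0
    · exact ⟨_, G.isFactor_noEdge_zero⟩
    -- For `n = 0` or `l = 0` there are no edges, and the bound on `r` forces `r = 0`.
    have hn0 : 0 < n := by
      by_contra h0
      obtain rfl : n = 0 := by omega
      have hδ0 : G.minDegree = 0 := by
        rw [Set.ncard_eq_zero hV] at hn
        rw [Graph.minDegree, hn, Set.image_empty, Nat.sInf_empty]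
      rw [hδ0] at hrle
      norm_num at hrle
      omega
    have hδ' := G.minDegree_add_le hV hn hn0 hl
    have hl0 : 0 < l := by
      by_contra h0
      obtain rfl : l = 0 := by omega
      have hδ0 : G.minDegree = 0 := by omega
      rw [hδ0] at hrle
      norm_num at hrle
      omega
    have hr2 : 2 ≤ r := by
      obtain ⟨k, rfl⟩ := hr
      omega
    exact G.exists_isFactor_of_counts hV hn hl hl0 hδ hr hr0
      fun s t q a e ha he _ hqa hq hq' =>
        tutte_inequality_of_le_add_sqrt hl0 hr2 hδ hδ' hrle ha he hqa hq hq'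
  · intro ξ hξ0 hξ
    refine ⟨⌈5 / ξ ^ 2⌉₊, ?_⟩
    intro α β G n l hnn hV hn hG hl hδ hΔ hΔδ r hr hrle
    rcases Nat.eq_zero_or_pos r with rfl | hr0
    · exact ⟨_, G.isFactor_noEdge_zero⟩
    have hnξ : 5 / ξ ^ 2 ≤ n := Nat.ceil_le.1 hnn
    have hn0 : 0 < n := by
      have : (0 : ℝ) < n := lt_of_lt_of_le (by positivity) hnξ
      exact_mod_cast this
    have hl0 : 0 < l := by
      by_contra h0
      obtain rfl : l = 0 := by omega
      have hδ' := G.minDegree_add_le hV hn hn0 hl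
      have hδ0 : G.minDegree = 0 := by omega
      rw [hδ0] at hrle
      norm_num at hrle
      omega
    exact G.exists_isFactor_of_counts hV hn hl hl0 hδ hr hr0
      fun s t q a e ha he he' hqa hq hq' =>
        tutte_inequality_of_almost_regular hξ0 hξ hl0 hnξ hΔ hΔδ hrle ha he he' hqa hq hq'
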